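/- Let $k$ be a field of prime characteristic $p$ that is $F$-finite (i.e. $F_*k$ is a finite $k$-module), let $S=k[x_1,\dots,x_d]$ with its standard $\mathbb N$-grading, let $I\subseteq S$ be a homogeneous ideal, and let $R=S/I$ with the induced $\mathbb N$-grading. For a commutative ring $A$ in which $p=0$, let $F_*^eA$ be the abelian group $A$ with elements written $F_*^es$ and with the $A$-module structure $r\cdot F_*^es=F_*^e(r^{p^e}s)$. The Cartier core of an ideal $J\subseteq A$ (with respect to the full Cartier algebra) is the ideal $$C_A(J)=\{r\in A \mid \varphi(F_*^e r)\in J\ \text{ for all } e>0 \text{ and all } \varphi\in\operatorname{Hom}_A(F_*^eA,A)\}.$$ For $f\in R$ with homogeneous components $f_i$ and degree $\deg f=\max\{i\mid f_i\neq0\}$, let $f^h=\sum_i f_i\,t^{\deg f-i}\in R[t]$ be its minimal homogenization (with $0^h=0$). For an ideal $J\subseteq R$ let $J^h=\langle f^h\mid f\in J\rangle\subseteq R[t]$. Let $\delta:R[t]\to R$ be the $R$-algebra map with $\delta(t)=1$. Then for every ideal $J$ of $R$, $$\bigl(C_R(J)\bigr)^h=C_{R[t]}(J^h)\qquad\text{and}\qquad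 C_R(J)=\delta\bigl(C_{R[t]}(J^h)\bigr).$$ -/

import Mathlib

/-- `p` is prime and `p = 0` in `R`.  For a nonzero ring this says exactly that `R` has prime
characteristic `p`; the zero ring is allowed. -/
class IsPrimeChar (p : ℕ) (R : Type*) [CommRing R] : Prop where
  prime : p.Prime
  cast_eq_zero : (p : R) = 0

instance IsPrimeChar.ofCharP (p : ℕ) [Fact p.Prime] (R : Type*) [CommRing R] [CharP R p] :
    IsPrimeChar p R :=
  ⟨Fact.out, CharP.cast_eq_zero R p⟩

instance IsPrimeChar.quotient (p : ℕ) (R : Type*) [CommRing R] [h : IsPrimeChar p R]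
    (I : Ideal R) : IsPrimeChar p (R ⧸ I) :=
  ⟨h.prime, by
    rw [← map_natCast (Ideal.Quotient.mk I) p, h.cast_eq_zero, map_zero]⟩

instance IsPrimeChar.polynomial (p : ℕ) (R : Type*) [CommRing R] [h : IsPrimeChar p R] :
    IsPrimeChar p (Polynomial R) :=
  ⟨h.prime, by
    rw [← map_natCast (Polynomial.C : R →+* Polynomial R) p, h.cast_eq_zero, map_zero]⟩

/-- The iterated Frobenius endomorphism `r ↦ r ^ (p ^ e)`. -/
def frobeniusPow (p e : ℕ) (R : Type*) [CommRing R] [h : IsPrimeChar p R] : R →+* R where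
  toFun r := r ^ p ^ e
  map_one' := one_pow _
  map_mul' x y := mul_pow x y _
  map_zero' := zero_pow (pow_ne_zero _ h.prime.ne_zero)
  map_add' x y := by
    obtain ⟨r, hr⟩ := exists_add_pow_prime_pow_eq h.prime x y e
    rw [hr, h.cast_eq_zero]
    ring

/-- The Frobenius pushforward `F_*^e R`: as an abelian group it is `R`. -/
def FrobeniusPushforward (_p _e : ℕ) (R : Type*) : Type _ := R

namespace FrobeniusPushforward

instance (p e : ℕ) (R : Type*) [CommRing R] : AddCommGroup (FrobeniusPushforward p e R) :=
  inferInstanceAs (AddCommGroup R)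

/-- The `R`-module structure `r • F_*^e s = F_*^e (r ^ (p ^ e) * s)`. -/
instance (p e : ℕ) (R : Type*) [CommRing R] [IsPrimeChar p R] :
    Module R (FrobeniusPushforward p e R) :=
  Module.compHom R (frobeniusPow p e R)

/-- The identification `r ↦ F_*^e r` of abelian groups. -/
def of (p e : ℕ) (R : Type*) [CommRing R] : R ≃+ FrobeniusPushforward p e R :=
  AddEquiv.refl R

theorem smul_of (p e : ℕ) {R : Type*} [CommRing R] [IsPrimeChar p R] (r s : R) :
    r • of p e R s = of p e R (r ^ p ^ e * s) := rfl

/-- Premultiplication `F_*^e s ↦ F_*^e (a * s)`, an `R`-linear endomorphism of `F_*^e R`. -/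
def mulLeft (p e : ℕ) {R : Type*} [CommRing R] [IsPrimeChar p R] (a : R) :
    FrobeniusPushforward p e R →ₗ[R] FrobeniusPushforward p e R where
  toFun s := of p e R (a * (of p e R).symm s)
  map_add' x y := by rw [map_add, mul_add, map_add]
  map_smul' r x := by
    obtain ⟨s, rfl⟩ := (of p e R).surjective x
    rw [smul_of, RingHom.id_apply, AddEquiv.symm_apply_apply, AddEquiv.symm_apply_apply, smul_of,
      mul_left_comm]

end FrobeniusPushforward

/-- `R` is `F`-finite: `F_* R` is a finite `R`-module. -/
def IsFFinite (p : ℕ) (R : Type*) [CommRing R] [IsPrimeChar p R] : Prop :=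
  Module.Finite R (FrobeniusPushforward p 1 R)

/-- The degree `e` piece `Hom_R(F_*^e R, R)` of the full Cartier algebra of `R`. -/
abbrev CartierPiece (p e : ℕ) (R : Type*) [CommRing R] [IsPrimeChar p R] : Type _ :=
  FrobeniusPushforward p e R →ₗ[R] R

/-- The Cartier core of `J` with respect to the full Cartier algebra of `R`: all `r` such that
`φ (F_*^e r) ∈ J` for all `e > 0` and all `φ ∈ Hom_R(F_*^e R, R)`. -/
def cartierCore (p : ℕ) {R : Type*} [CommRing R] [IsPrimeChar p R] (J : Ideal R) : Ideal R where
  carrier := {r | ∀ e : ℕ, 0 < e → ∀ φ : CartierPiece p e R,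
    φ (FrobeniusPushforward.of p e R r) ∈ J}
  zero_mem' e _ φ := by
    rw [map_zero, map_zero]
    exact J.zero_mem
  add_mem' ha hb e he φ := by
    rw [map_add, map_add]
    exact J.add_mem (ha e he φ) (hb e he φ)
  smul_mem' a _ hr e he φ := hr e he (φ.comp (FrobeniusPushforward.mulLeft p e a))

section Grading

variable {k A : Type*} [CommRing k] [CommRing A] [Algebra k A]

/-- The grading of `A ⧸ I` induced by a grading `𝒜` of `A`: the degree `i` piece is the image of
`𝒜 i`. -/
def quotientGrading (𝒜 : ℕ → Submodule k A) (I : Ideal A) (i : ℕ) : Submodule k (A ⧸ I) :=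
  (𝒜 i).map (Ideal.Quotient.mkₐ k I).toLinearMap

/-- The quotient map `𝒜 i → (A ⧸ I)_i` in degree `i`. -/
def quotientGradingPiece (𝒜 : ℕ → Submodule k A) (I : Ideal A) (i : ℕ) :
    𝒜 i →+ quotientGrading 𝒜 I i where
  toFun a := ⟨Ideal.Quotient.mk I a, a, a.2, rfl⟩
  map_zero' := rfl
  map_add' _ _ := rfl

/-- The map `⨁ 𝒜 i → ⨁ (A ⧸ I)_i` induced by the quotient map. -/
noncomputable def quotientGradingMap (𝒜 : ℕ → Submodule k A) (I : Ideal A) :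
    (DirectSum ℕ fun i => 𝒜 i) →+ DirectSum ℕ fun i => quotientGrading 𝒜 I i :=
  DirectSum.map (quotientGradingPiece 𝒜 I)

theorem quotientGradingMap_eq_zero (𝒜 : ℕ → Submodule k A) [GradedAlgebra 𝒜] (I : Ideal A)
    (hI : I.IsHomogeneous 𝒜) (a : A) (ha : a ∈ I) :
    quotientGradingMap 𝒜 I (DirectSum.decompose 𝒜 a) = 0 := by
  refine DFinsupp.ext fun i => Subtype.ext ?_
  exact Ideal.Quotient.eq_zero_iff_mem.2 (hI i ha)

theorem coe_quotientGradingMap (𝒜 : ℕ → Submodule k A) (I : Ideal A)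
    (x : DirectSum ℕ fun i => 𝒜 i) :
    DirectSum.coeAddMonoidHom (quotientGrading 𝒜 I) (quotientGradingMap 𝒜 I x) =
      Ideal.Quotient.mk I (DirectSum.coeAddMonoidHom 𝒜 x) := by
  induction x using DirectSum.induction_on with
  | zero => simp only [map_zero]
  | of i x =>
    rw [quotientGradingMap, DirectSum.map_of, DirectSum.coeAddMonoidHom_of,
      DirectSum.coeAddMonoidHom_of]
    rfl
  | add x y hx hy => simp only [map_add, hx, hy]

theorem quotientGradingMap_surjective (𝒜 : ℕ → Submodule k A) (I : Ideal A) :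
    Function.Surjective (quotientGradingMap 𝒜 I) :=
  (DirectSum.map_surjective _).2 fun i => by
    rintro ⟨_, a, ha, rfl⟩
    exact ⟨⟨a, ha⟩, rfl⟩

/-- If `I` is a homogeneous ideal of the graded ring `A`, then `A ⧸ I` is graded. -/
@[reducible]
noncomputable def quotientGradedAlgebra (𝒜 : ℕ → Submodule k A) [GradedAlgebra 𝒜] (I : Ideal A)
    (hI : I.IsHomogeneous 𝒜) : GradedAlgebra (quotientGrading 𝒜 I) where
  one_mem := ⟨1, SetLike.GradedOne.one_mem, map_one (Ideal.Quotient.mkₐ k I)⟩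
  mul_mem := by
    rintro i j _ _ ⟨a, ha, rfl⟩ ⟨b, hb, rfl⟩
    exact ⟨a * b, SetLike.GradedMul.mul_mem ha hb, map_mul (Ideal.Quotient.mkₐ k I) a b⟩
  decompose' :=
    QuotientAddGroup.lift (Submodule.toAddSubgroup I)
      ((quotientGradingMap 𝒜 I).comp (DirectSum.decomposeAddEquiv 𝒜).toAddMonoidHom)
      (quotientGradingMap_eq_zero 𝒜 I hI)
  left_inv x := by
    obtain ⟨a, rfl⟩ := Ideal.Quotient.mk_surjective x
    refine (coe_quotientGradingMap 𝒜 I (DirectSum.decompose 𝒜 a)).trans ?_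
    exact congrArg (Ideal.Quotient.mk I) ((DirectSum.decompose 𝒜).left_inv a)
  right_inv y := by
    obtain ⟨x, rfl⟩ := quotientGradingMap_surjective 𝒜 I y
    rw [coe_quotientGradingMap]
    exact congrArg (quotientGradingMap 𝒜 I) ((DirectSum.decompose 𝒜).right_inv x)

/-- The degree `i` component of the class of `a` is the class of the degree `i` component of `a`. -/
theorem decompose_quotient_mk (𝒜 : ℕ → Submodule k A) [GradedAlgebra 𝒜] (I : Ideal A)
    (hI : I.IsHomogeneous 𝒜) (a : A) (i : ℕ) :
    letI := quotientGradedAlgebra 𝒜 I hI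
    (DirectSum.decompose (quotientGrading 𝒜 I) (Ideal.Quotient.mk I a) i : A ⧸ I) =
      Ideal.Quotient.mk I (DirectSum.decompose 𝒜 a i : A) :=
  rfl

end Grading

section Homogenization

variable {R : Type*} [CommRing R] {σ : Type*} [SetLike σ R] [AddSubmonoidClass σ R]
  (𝒜 : ℕ → σ) [GradedRing 𝒜]

open Classical in
/-- The degree of `f` in an `ℕ`-graded ring: the largest degree of a nonzero homogeneous component
(`0` for `f = 0`). -/
noncomputable def gradedDegree (f : R) : ℕ :=
  (DirectSum.decompose 𝒜 f).support.sup id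

open Classical in
/-- The minimal homogenization `f ^ h = ∑ i, f_i * t ^ (deg f - i)` in `R[t]`, where `f_i` is the
degree `i` homogeneous component of `f`. -/
noncomputable def homogenization (f : R) : Polynomial R :=
  ∑ i ∈ (DirectSum.decompose 𝒜 f).support,
    Polynomial.C (DirectSum.decompose 𝒜 f i : R) * Polynomial.X ^ (gradedDegree 𝒜 f - i)

/-- The homogenization of an ideal `J`: the ideal of `R[t]` generated by the `f ^ h`, `f ∈ J`. -/
noncomputable def idealHomogenization (J : Ideal R) : Ideal (Polynomial R) :=
  Ideal.span (homogenization 𝒜 '' (J : Set R))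

/-- Dehomogenization `R[t] → R`, the `R`-algebra map with `t ↦ 1`. -/
noncomputable def dehomogenization (R : Type*) [CommRing R] : Polynomial R →+* R :=
  Polynomial.evalRingHom 1

end Homogenization

attribute [local instance] MvPolynomial.gradedAlgebra

/-! Grade `R[t]` by total degree, with `t` in degree 1. A homogeneous `g` is a power of `t` times
`(δ g)^h`, so it lies in `J^h` exactly when `δ g ∈ J`. The ideal `J^h` is homogeneous, and hence so
is its Cartier core (`cartierCore_isHomogeneous`, by taking graded components of Cartier maps). Both
equalities thus reduce to moving Cartier maps between `R` and `R[t]`; write `q = p ^ e`.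

Every `ψ` on `R` extends to `R[t]` compatibly with `δ` (`dehomogenization_polynomialExtension`), so
`δ` carries the core of `J^h` into the core of `J`. Conversely, `φ` on `R[t]` and `n = deg f` give a
Cartier map on `R` whose value at `f` is `δ (φ (f^h))` (`dehomogenizedCartierMap_gradedDegree`). So
`f` in the core of `J` forces `f^h` into the core of `J^h`. -/

open DirectSum

/-! ### The total-degree grading on `R[t]` -/

section TotalGrading

variable {R : Type*} [CommRing R] {σ : Type*} [SetLike σ R] [AddSubmonoidClass σ R]
  (𝒜 : ℕ → σ)

/-- The polynomials over an `ℕ`-graded ring which are homogeneous of total degree `n`, where the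
variable has degree `1`. -/
def totalGrading (n : ℕ) : AddSubmonoid (Polynomial R) where
  carrier := {g | ∀ a, (a ≤ n → g.coeff a ∈ 𝒜 (n - a)) ∧ (n < a → g.coeff a = 0)}
  zero_mem' a := by simp
  add_mem' {f g} hf hg a :=
    ⟨fun h => by simpa using add_mem ((hf a).1 h) ((hg a).1 h),
      fun h => by simp [(hf a).2 h, (hg a).2 h]⟩

theorem monomial_mem_totalGrading {i a : ℕ} {r : R} (hr : r ∈ 𝒜 i) :
    Polynomial.monomial a r ∈ totalGrading 𝒜 (i + a) := by
  intro b
  rw [Polynomial.coeff_monomial]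
  split_ifs with h
  · subst h
    exact ⟨fun _ => by simpa using hr, fun h => by omega⟩
  · exact ⟨fun _ => zero_mem _, fun _ => rfl⟩

/-- The map `𝒜 i → R[t]_(i + a)` sending `r` to `r * t ^ a`. -/
noncomputable def totalGradingMonomial (i a : ℕ) : 𝒜 i →+ totalGrading 𝒜 (i + a) where
  toFun r := ⟨Polynomial.monomial a (r : R), monomial_mem_totalGrading 𝒜 r.2⟩
  map_zero' := Subtype.ext (by simp)
  map_add' r s := Subtype.ext (by simp)

variable [GradedRing 𝒜]

theorem totalGrading_gradedMonoid : SetLike.GradedMonoid (totalGrading 𝒜) where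
  one_mem := by
    simpa using monomial_mem_totalGrading 𝒜 (a := 0) (SetLike.GradedOne.one_mem (A := 𝒜))
  mul_mem m n f g hf hg a := by
    rw [Polynomial.coeff_mul]
    constructor
    · intro ha
      refine sum_mem fun x hx => ?_
      rw [Finset.HasAntidiagonal.mem_antidiagonal] at hx
      by_cases h1 : x.1 ≤ m
      · by_cases h2 : x.2 ≤ n
        · have := SetLike.GradedMul.mul_mem ((hf x.1).1 h1) ((hg x.2).1 h2)
          rwa [show m - x.1 + (n - x.2) = m + n - a by omega] at this
        · rw [(hg x.2).2 (by omega), mul_zero]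
          exact zero_mem _
      · rw [(hf x.1).2 (by omega), zero_mul]
        exact zero_mem _
    · intro ha
      refine Finset.sum_eq_zero fun x hx => ?_
      rw [Finset.HasAntidiagonal.mem_antidiagonal] at hx
      by_cases h1 : x.1 ≤ m
      · rw [(hg x.2).2 (by omega), mul_zero]
      · rw [(hf x.1).2 (by omega), zero_mul]

/-- The decomposition of `r * t ^ a` into its components of given total degree. -/
noncomputable def totalDecomposeMonomial (a : ℕ) : R →+ ⨁ n, totalGrading 𝒜 n :=
  (DirectSum.toAddMonoid fun i =>
    (DirectSum.of (fun n => totalGrading 𝒜 n) (i + a)).comp (totalGradingMonomial 𝒜 i a)).comp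
    (decomposeAddEquiv 𝒜).toAddMonoidHom

theorem totalDecomposeMonomial_of_mem {i a : ℕ} {r : R} (hr : r ∈ 𝒜 i) :
    totalDecomposeMonomial 𝒜 a r =
      DirectSum.of (fun n => totalGrading 𝒜 n) (i + a)
        ⟨Polynomial.monomial a r, monomial_mem_totalGrading 𝒜 hr⟩ := by
  change DirectSum.toAddMonoid _ (decompose 𝒜 r) = _
  rw [decompose_of_mem 𝒜 hr, DirectSum.toAddMonoid_of]
  rfl

/-- The decomposition of a polynomial into its components of given total degree. -/
noncomputable def totalDecompose : Polynomial R →+ ⨁ n, totalGrading 𝒜 n where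
  toFun g := g.sum fun a r => totalDecomposeMonomial 𝒜 a r
  map_zero' := Polynomial.sum_zero_index _
  map_add' f g := Polynomial.sum_add_index f g _ (fun _ => map_zero _) (fun _ => map_add _)

theorem totalDecompose_monomial (a : ℕ) (r : R) :
    totalDecompose 𝒜 (Polynomial.monomial a r) = totalDecomposeMonomial 𝒜 a r :=
  Polynomial.sum_monomial_index r _ (map_zero _)

theorem totalDecompose_of_mem {n : ℕ} {g : Polynomial R} (hg : g ∈ totalGrading 𝒜 n) :
    totalDecompose 𝒜 g = DirectSum.of (fun n => totalGrading 𝒜 n) n ⟨g, hg⟩ := by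
  -- Every term of `g` lies in degree `n`, those with `a > n` because they vanish; so `g` can be
  -- summed inside the degree `n` piece.
  have key (a : ℕ) : ∃ h : Polynomial.monomial a (g.coeff a) ∈ totalGrading 𝒜 n,
      totalDecompose 𝒜 (Polynomial.monomial a (g.coeff a)) =
        DirectSum.of (fun n => totalGrading 𝒜 n) n ⟨_, h⟩ := by
    rw [totalDecompose_monomial]
    rcases le_or_gt a n with ha | ha
    · obtain ⟨i, rfl⟩ := Nat.exists_eq_add_of_le' ha
      have hi : g.coeff a ∈ 𝒜 i := by simpa using (hg a).1 ha
      exact ⟨monomial_mem_totalGrading 𝒜 hi, totalDecomposeMonomial_of_mem 𝒜 hi⟩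
    · refine ⟨by rw [(hg a).2 ha, map_zero]; exact zero_mem _, ?_⟩
      simp only [(hg a).2 ha, map_zero]
      exact (map_zero (DirectSum.of (fun n => totalGrading 𝒜 n) n)).symm
  choose h1 h2 using key
  have hs : (⟨g, hg⟩ : totalGrading 𝒜 n) = ∑ a ∈ g.support, ⟨_, h1 a⟩ :=
    Subtype.ext (by
      rw [AddSubmonoid.coe_finsetSum]
      exact g.as_sum_support)
  rw [hs, map_sum, ← Finset.sum_congr rfl fun a _ => h2 a, ← map_sum, ← g.as_sum_support]

theorem coe_totalDecompose (g : Polynomial R) :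
    DirectSum.coeAddMonoidHom (totalGrading 𝒜) (totalDecompose 𝒜 g) = g := by
  induction g using Polynomial.induction_on' with
  | add f g hf hg => rw [map_add, map_add, hf, hg]
  | monomial a r =>
    induction r using DirectSum.Decomposition.inductionOn 𝒜 with
    | zero => simp
    | add r s hr hs => rw [map_add, map_add, map_add, hr, hs]
    | @homogeneous i r =>
      rw [totalDecompose_monomial, totalDecomposeMonomial_of_mem 𝒜 r.2,
        DirectSum.coeAddMonoidHom_of]

/-- The polynomial ring over an `ℕ`-graded ring is graded by total degree. -/
@[reducible]
noncomputable def totalGradedRing : GradedRing (totalGrading 𝒜) where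
  __ := totalGrading_gradedMonoid 𝒜
  decompose' := totalDecompose 𝒜
  left_inv := coe_totalDecompose 𝒜
  right_inv x := by
    induction x using DirectSum.induction_on with
    | zero => simp only [map_zero]
    | of i x => rw [DirectSum.coeAddMonoidHom_of, totalDecompose_of_mem 𝒜 x.2]
    | add x y hx hy => simp only [map_add, hx, hy]

end TotalGrading

/-! ### Homogeneous elements of `R[t]` and homogenized ideals -/

section Homogenization

variable {R : Type*} [CommRing R] {σ : Type*} [SetLike σ R] [AddSubmonoidClass σ R]
  (𝒜 : ℕ → σ) [GradedRing 𝒜]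

open Classical in
theorem le_gradedDegree {f : R} {i : ℕ} (hi : i ∈ (decompose 𝒜 f).support) :
    i ≤ gradedDegree 𝒜 f :=
  Finset.le_sup (f := id) (by convert hi)

theorem homogenization_mem_totalGrading (f : R) :
    homogenization 𝒜 f ∈ totalGrading 𝒜 (gradedDegree 𝒜 f) := by
  classical
  refine sum_mem fun i hi => ?_
  rw [Polynomial.C_mul_X_pow_eq_monomial]
  have := monomial_mem_totalGrading 𝒜 (a := gradedDegree 𝒜 f - i) (decompose 𝒜 f i).2
  rwa [Nat.add_sub_cancel' (le_gradedDegree 𝒜 (by convert hi))] at this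

theorem dehomogenization_homogenization (f : R) :
    dehomogenization R (homogenization 𝒜 f) = f := by
  classical
  conv_rhs => rw [← sum_support_decompose 𝒜 f]
  simp only [homogenization, dehomogenization, Polynomial.coe_evalRingHom,
    Polynomial.eval_finsetSum, Polynomial.eval_mul, Polynomial.eval_C, Polynomial.eval_pow,
    Polynomial.eval_X, one_pow, mul_one]

theorem dehomogenization_mem {J : Ideal R} {g : Polynomial R}
    (hg : g ∈ idealHomogenization 𝒜 J) : dehomogenization R g ∈ J := by
  suffices h : idealHomogenization 𝒜 J ≤ J.comap (dehomogenization R) from h hg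
  rw [idealHomogenization, Ideal.span_le]
  rintro _ ⟨f, hf, rfl⟩
  simpa [dehomogenization_homogenization] using hf

theorem idealHomogenization_isHomogeneous (J : Ideal R) :
    letI := totalGradedRing 𝒜
    (idealHomogenization 𝒜 J).IsHomogeneous (totalGrading 𝒜) := by
  let _ := totalGradedRing 𝒜
  refine Ideal.homogeneous_span _ _ ?_
  rintro _ ⟨f, -, rfl⟩
  exact ⟨_, homogenization_mem_totalGrading 𝒜 f⟩

/-- The coefficients of a form of degree `n` lie in pairwise different degrees `n - a`, so setting
`t = 1` loses no information once `n` is known. -/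
theorem coeff_eq_decompose_dehomogenization {n a : ℕ} {g : Polynomial R}
    (hg : g ∈ totalGrading 𝒜 n) (ha : a ≤ n) :
    g.coeff a = decompose 𝒜 (dehomogenization R g) (n - a) := by
  classical
  have h : dehomogenization R g = ∑ b ∈ Finset.range (n + 1), g.coeff b := by
    rw [dehomogenization, Polynomial.coe_evalRingHom, Polynomial.eval_eq_sum_range' (n := n + 1)]
    · simp
    · refine Nat.lt_succ_of_le (Polynomial.natDegree_le_iff_coeff_eq_zero.2 fun b hb => ?_)
      exact (hg b).2 hb
  rw [h, decompose_sum, DirectSum.sum_apply, AddSubmonoidClass.coe_finsetSum,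
    Finset.sum_eq_single a]
  · exact (decompose_of_mem_same 𝒜 ((hg a).1 ha)).symm
  · intro b hb hba
    have hb' := Finset.mem_range.1 hb
    exact decompose_of_mem_ne 𝒜 ((hg b).1 (by omega)) (by omega)
  · intro h
    exact absurd (Finset.mem_range.2 (by omega)) h

theorem gradedDegree_dehomogenization_le {n : ℕ} {g : Polynomial R}
    (hg : g ∈ totalGrading 𝒜 n) : gradedDegree 𝒜 (dehomogenization R g) ≤ n := by
  classical
  refine Finset.sup_le fun i hi => ?_
  by_contra hn
  rw [DFinsupp.mem_support_iff] at hi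
  refine hi (Subtype.ext ?_)
  rw [dehomogenization, Polynomial.coe_evalRingHom, Polynomial.eval_eq_sum, Polynomial.sum,
    decompose_sum, DirectSum.sum_apply, AddSubmonoidClass.coe_finsetSum]
  refine Finset.sum_eq_zero fun b _ => ?_
  rw [one_pow, mul_one]
  rcases le_or_gt b n with hb | hb
  · exact decompose_of_mem_ne 𝒜 ((hg b).1 hb) (by simp only [id] at hn; omega)
  · rw [(hg b).2 hb, decompose_zero]
    rfl

/-- A homogeneous polynomial is a power of `t` times the homogenization of its
dehomogenization. -/
theorem eq_X_pow_mul_homogenization {n : ℕ} {g : Polynomial R} (hg : g ∈ totalGrading 𝒜 n) :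
    g = Polynomial.X ^ (n - gradedDegree 𝒜 (dehomogenization R g)) *
      homogenization 𝒜 (dehomogenization R g) := by
  let _ := totalGradedRing 𝒜
  have hX : (Polynomial.X ^ (n - gradedDegree 𝒜 (dehomogenization R g)) : Polynomial R) ∈
      totalGrading 𝒜 (n - gradedDegree 𝒜 (dehomogenization R g)) := by
    have := monomial_mem_totalGrading 𝒜 (a := n - gradedDegree 𝒜 (dehomogenization R g))
      (SetLike.GradedOne.one_mem (A := 𝒜))
    rwa [zero_add, Polynomial.monomial_one_right_eq_X_pow] at this
  have hg' := SetLike.GradedMul.mul_mem hX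
    (homogenization_mem_totalGrading 𝒜 (dehomogenization R g))
  rw [Nat.sub_add_cancel (gradedDegree_dehomogenization_le 𝒜 hg)] at hg'
  -- Both sides are forms of degree `n` with the same dehomogenization, so their coefficients agree.
  ext a
  rcases le_or_gt a n with ha | ha
  · rw [coeff_eq_decompose_dehomogenization 𝒜 hg ha,
      coeff_eq_decompose_dehomogenization 𝒜 hg' ha, map_mul, dehomogenization_homogenization]
    simp [dehomogenization]
  · rw [(hg a).2 ha, (hg' a).2 ha]

/-- Converse of `dehomogenization_mem`, valid for forms only. -/
theorem mem_idealHomogenization_of_mem_totalGrading {J : Ideal R} {n : ℕ} {g : Polynomial R}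
    (hg : g ∈ totalGrading 𝒜 n) (hJ : dehomogenization R g ∈ J) :
    g ∈ idealHomogenization 𝒜 J := by
  rw [eq_X_pow_mul_homogenization 𝒜 hg]
  exact Ideal.mul_mem_left _ _ (Ideal.subset_span ⟨_, hJ, rfl⟩)

end Homogenization

/-! ### Graded components of Cartier maps -/

/-- An additive map `f` with `f (r ^ (p ^ e) * s) = r * f s`, as an element of
`Hom_A(F_*^e A, A)`. -/
def CartierPiece.ofAddMonoidHom {p e : ℕ} {A : Type*} [CommRing A] [IsPrimeChar p A]
    (f : A →+ A) (hf : ∀ r s, f (r ^ p ^ e * s) = r * f s) : CartierPiece p e A where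
  toFun x := f ((FrobeniusPushforward.of p e A).symm x)
  map_add' x y := by rw [map_add, map_add]
  map_smul' r x := by
    obtain ⟨s, rfl⟩ := (FrobeniusPushforward.of p e A).surjective x
    exact hf r s

theorem CartierPiece.map_pow_mul {p e : ℕ} {A : Type*} [CommRing A] [IsPrimeChar p A]
    (φ : CartierPiece p e A) (r s : A) :
    φ (FrobeniusPushforward.of p e A (r ^ p ^ e * s)) =
      r * φ (FrobeniusPushforward.of p e A s) := by
  rw [← FrobeniusPushforward.smul_of, map_smul, smul_eq_mul]

section Graded

variable {A : Type*} [CommRing A] {σ : Type*} [SetLike σ A] [AddSubmonoidClass σ A]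
  (𝒜 : ℕ → σ) [GradedRing 𝒜]

open Classical in
/-- The projection to the homogeneous component of degree `m + (i - n) / q`, which is zero if this
is not a natural number. -/
noncomputable def shiftedProj (q n m i : ℕ) : A →+ A :=
  if h : ∃ l, q * l + n = i + q * m then GradedRing.proj 𝒜 h.choose else 0

variable {q n m i : ℕ}

theorem shiftedProj_eq (hq : 0 < q) {l : ℕ} (hl : q * l + n = i + q * m) :
    shiftedProj 𝒜 q n m i = GradedRing.proj 𝒜 l := by
  have h : ∃ l, q * l + n = i + q * m := ⟨l, hl⟩
  rw [shiftedProj, dif_pos h,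
    Nat.eq_of_mul_eq_mul_left hq (by have := h.choose_spec; omega : q * h.choose = q * l)]

theorem shiftedProj_eq_zero (h : ¬∃ l, q * l + n = i + q * m) :
    shiftedProj 𝒜 q n m i = 0 :=
  dif_neg h

/-- Multiplying the argument of a Cartier map by `r ^ q` raises its degree by `q * j` and that of
the value by `j`; this is what makes the components `p ^ e`-linear. -/
theorem shiftedProj_mul (hq : 0 < q) {j : ℕ} {r : A} (hr : r ∈ 𝒜 j) (y : A) :
    shiftedProj 𝒜 q n m (q * j + i) (r * y) = r * shiftedProj 𝒜 q n m i y := by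
  by_cases h : ∃ l, q * l + n = i + q * m
  · obtain ⟨l, hl⟩ := h
    rw [shiftedProj_eq 𝒜 hq hl, shiftedProj_eq 𝒜 hq (l := j + l) (by rw [mul_add]; omega)]
    exact coe_decompose_mul_add_of_left_mem 𝒜 hr
  · rw [shiftedProj_eq_zero 𝒜 h, AddMonoidHom.zero_apply, mul_zero]
    -- The target degree for `i` may be negative while the shifted one `l` is not; then `l < j`, and
    -- `r * y` has no component there.
    by_cases h' : ∃ l, q * l + n = q * j + i + q * m
    · obtain ⟨l, hl⟩ := h'
      rw [shiftedProj_eq 𝒜 hq hl]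
      refine coe_decompose_mul_of_left_mem_of_not_le 𝒜 hr fun hjl => h ?_
      obtain ⟨c, rfl⟩ := Nat.exists_eq_add_of_le hjl
      exact ⟨c, by rw [mul_add] at hl; omega⟩
    · rw [shiftedProj_eq_zero 𝒜 h', AddMonoidHom.zero_apply]

theorem proj_shiftedProj_of_ne (hq : 0 < q) (h : i ≠ n) (y : A) :
    GradedRing.proj 𝒜 m (shiftedProj 𝒜 q n m i y) = 0 := by
  by_cases h' : ∃ l, q * l + n = i + q * m
  · obtain ⟨l, hl⟩ := h'
    rw [shiftedProj_eq 𝒜 hq hl]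
    refine decompose_of_mem_ne 𝒜 (decompose 𝒜 y l).2 ?_
    rintro rfl
    omega
  · rw [shiftedProj_eq_zero 𝒜 h', AddMonoidHom.zero_apply, map_zero]

variable {p e : ℕ} [IsPrimeChar p A]

/-- The homogeneous component of `φ` which maps `F_*^e A_n` to `A_m`, as an additive map. -/
noncomputable def cartierComponentHom (φ : CartierPiece p e A) (n m : ℕ) : A →+ A :=
  (DirectSum.toAddMonoid fun i =>
    ((shiftedProj 𝒜 (p ^ e) n m i).comp
      (φ.toAddMonoidHom.comp (FrobeniusPushforward.of p e A).toAddMonoidHom)).comp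
        (AddSubmonoidClass.subtype (𝒜 i))).comp (decomposeAddEquiv 𝒜).toAddMonoidHom

theorem cartierComponentHom_of_mem (φ : CartierPiece p e A) {x : A} (hx : x ∈ 𝒜 i) :
    cartierComponentHom 𝒜 φ n m x =
      shiftedProj 𝒜 (p ^ e) n m i (φ (FrobeniusPushforward.of p e A x)) := by
  change DirectSum.toAddMonoid _ (decompose 𝒜 x) = _
  rw [decompose_of_mem 𝒜 hx, DirectSum.toAddMonoid_of]
  rfl

theorem cartierComponentHom_pow_mul (φ : CartierPiece p e A) (r s : A) :
    cartierComponentHom 𝒜 φ n m (r ^ p ^ e * s) = r * cartierComponentHom 𝒜 φ n m s := by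
  have hp : p.Prime := IsPrimeChar.prime A
  induction r using DirectSum.Decomposition.inductionOn 𝒜 with
  | zero => rw [zero_pow (pow_ne_zero _ hp.ne_zero), zero_mul, zero_mul, map_zero]
  | add r r' hr hr' =>
    have : (r + r') ^ p ^ e = r ^ p ^ e + r' ^ p ^ e := map_add (frobeniusPow p e A) r r'
    rw [this, add_mul, add_mul, map_add, hr, hr']
  | @homogeneous j r =>
    induction s using DirectSum.Decomposition.inductionOn 𝒜 with
    | zero => simp only [mul_zero, map_zero]
    | add s s' hs hs' => rw [mul_add, map_add, map_add, mul_add, hs, hs']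
    | @homogeneous i s =>
      have hrs : (r : A) ^ p ^ e * s ∈ 𝒜 (p ^ e * j + i) := by
        have := SetLike.GradedMul.mul_mem (SetLike.pow_mem_graded (p ^ e) r.2) s.2
        rwa [smul_eq_mul] at this
      rw [cartierComponentHom_of_mem 𝒜 φ hrs, cartierComponentHom_of_mem 𝒜 φ s.2,
        φ.map_pow_mul, shiftedProj_mul 𝒜 (pow_pos hp.pos e) r.2]

/-- The homogeneous component of `φ` which maps `F_*^e A_n` to `A_m`. -/
noncomputable def cartierComponent (φ : CartierPiece p e A) (n m : ℕ) : CartierPiece p e A :=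
  CartierPiece.ofAddMonoidHom (cartierComponentHom 𝒜 φ n m) (cartierComponentHom_pow_mul 𝒜 φ)

theorem cartierComponent_of_mem (φ : CartierPiece p e A) {x : A} (hx : x ∈ 𝒜 n) :
    cartierComponent 𝒜 φ n m (FrobeniusPushforward.of p e A x) =
      decompose 𝒜 (φ (FrobeniusPushforward.of p e A x)) m := by
  have hp : p.Prime := IsPrimeChar.prime A
  exact (cartierComponentHom_of_mem 𝒜 φ hx).trans
    (DFunLike.congr_fun (shiftedProj_eq 𝒜 (pow_pos hp.pos e) (add_comm _ _)) _)

/-- Inputs of degree other than `n` have values outside degree `m`, so the degree `m` part of the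
value sees only `x_n`. -/
theorem decompose_cartierComponent (φ : CartierPiece p e A) (x : A) :
    (decompose 𝒜 (cartierComponent 𝒜 φ n m (FrobeniusPushforward.of p e A x)) m : A) =
      decompose 𝒜 (φ (FrobeniusPushforward.of p e A (decompose 𝒜 x n))) m := by
  have hp : p.Prime := IsPrimeChar.prime A
  induction x using DirectSum.Decomposition.inductionOn 𝒜 with
  | zero => simp
  | add x y hx hy => simp [hx, hy]
  | @homogeneous i x =>
    rcases eq_or_ne i n with rfl | h
    · rw [cartierComponent_of_mem 𝒜 φ x.2, decompose_coe, DirectSum.of_eq_same,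
        decompose_coe, DirectSum.of_eq_same]
    · rw [decompose_of_mem_ne 𝒜 x.2 h, map_zero, map_zero, decompose_zero]
      refine Eq.trans ?_ (proj_shiftedProj_of_ne 𝒜 (m := m) (pow_pos hp.pos e) h
        (φ (FrobeniusPushforward.of p e A x)))
      rw [← cartierComponentHom_of_mem 𝒜 φ x.2]
      rfl

/-- The Cartier core of a homogeneous ideal is homogeneous. -/
theorem cartierCore_isHomogeneous {J : Ideal A} (hJ : J.IsHomogeneous 𝒜) :
    (cartierCore p J).IsHomogeneous 𝒜 := by
  intro n x hx e he φ
  rw [hJ.mem_iff]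
  intro m
  -- This trades `φ` at `x_n` for another Cartier map at `x` itself, where the hypothesis on `x`
  -- applies.
  rw [← decompose_cartierComponent 𝒜 φ x]
  exact hJ m (hx e he _)

end Graded

/-! ### Extending Cartier maps from `R` to `R[t]` -/

section Dehomogenize

variable {R : Type*} [CommRing R] {p e : ℕ} [IsPrimeChar p R]

/-- The extension of `ψ` to `F_*^e R[t]` with `F_*^e (r * t ^ a) ↦ ψ (F_*^e r) * t ^ ⌊a / p ^ e⌋`,
as an additive map. -/
noncomputable def polynomialExtensionHom (ψ : CartierPiece p e R) :
    Polynomial R →+ Polynomial R where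
  toFun g := g.sum fun a r =>
    Polynomial.monomial (a / p ^ e) (ψ (FrobeniusPushforward.of p e R r))
  map_zero' := Polynomial.sum_zero_index _
  map_add' f g := Polynomial.sum_add_index f g _ (fun _ => by simp) (fun _ _ _ => by simp)

theorem polynomialExtensionHom_monomial (ψ : CartierPiece p e R) (a : ℕ) (r : R) :
    polynomialExtensionHom ψ (Polynomial.monomial a r) =
      Polynomial.monomial (a / p ^ e) (ψ (FrobeniusPushforward.of p e R r)) :=
  Polynomial.sum_monomial_index (f := fun a r =>
    Polynomial.monomial (a / p ^ e) (ψ (FrobeniusPushforward.of p e R r))) r (by simp)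

/-- On monomials this is `⌊(q * b + a) / q⌋ = b + ⌊a / q⌋`. -/
theorem polynomialExtensionHom_pow_mul (ψ : CartierPiece p e R) (f g : Polynomial R) :
    polynomialExtensionHom ψ (f ^ p ^ e * g) = f * polynomialExtensionHom ψ g := by
  have hp : p.Prime := IsPrimeChar.prime R
  induction f using Polynomial.induction_on' with
  | add f f' hf hf' =>
    have : (f + f') ^ p ^ e = f ^ p ^ e + f' ^ p ^ e :=
      map_add (frobeniusPow p e (Polynomial R)) f f'
    rw [this, add_mul, add_mul, map_add, hf, hf']
  | monomial b r =>
    induction g using Polynomial.induction_on' with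
    | add g g' hg hg' => rw [mul_add, map_add, map_add, mul_add, hg, hg']
    | monomial a s =>
      rw [Polynomial.monomial_pow, Polynomial.monomial_mul_monomial,
        polynomialExtensionHom_monomial, polynomialExtensionHom_monomial, ψ.map_pow_mul,
        Polynomial.monomial_mul_monomial, mul_comm b, Nat.mul_add_div (pow_pos hp.pos e)]

/-- The extension of `ψ` to `F_*^e R[t]` with
`F_*^e (r * t ^ a) ↦ ψ (F_*^e r) * t ^ ⌊a / p ^ e⌋`. -/
noncomputable def polynomialExtension (ψ : CartierPiece p e R) :
    CartierPiece p e (Polynomial R) :=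
  CartierPiece.ofAddMonoidHom (polynomialExtensionHom ψ) (polynomialExtensionHom_pow_mul ψ)

theorem dehomogenization_polynomialExtension (ψ : CartierPiece p e R) (g : Polynomial R) :
    dehomogenization R (polynomialExtension ψ (FrobeniusPushforward.of p e _ g)) =
      ψ (FrobeniusPushforward.of p e R (dehomogenization R g)) := by
  induction g using Polynomial.induction_on' with
  | add f g hf hg => simp only [map_add, hf, hg]
  | monomial a r =>
    have : polynomialExtension ψ (FrobeniusPushforward.of p e _ (Polynomial.monomial a r)) =
      Polynomial.monomial (a / p ^ e) (ψ (FrobeniusPushforward.of p e R r)) :=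
      polynomialExtensionHom_monomial ψ a r
    simp [this, dehomogenization]

variable {σ : Type*} [SetLike σ R] [AddSubmonoidClass σ R] (𝒜 : ℕ → σ) [GradedRing 𝒜]

theorem dehomogenization_mem_cartierCore {J : Ideal R} {g : Polynomial R}
    (hg : g ∈ cartierCore p (idealHomogenization 𝒜 J)) :
    dehomogenization R g ∈ cartierCore p J := by
  intro e he ψ
  rw [← dehomogenization_polynomialExtension]
  exact dehomogenization_mem 𝒜 (hg e he _)

/-! ### Descending Cartier maps from `R[t]` to `R` -/

/-- The ring homomorphism `R → R[t]` sending `r` of degree `i` to `r * t ^ (i * c)`. -/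
noncomputable def scaledCoaction (c : ℕ) : R →+* Polynomial R :=
  (DirectSum.toSemiring
    (fun i => (Polynomial.monomial (R := R) (i * c)).toAddMonoidHom.comp
      (AddSubmonoidClass.subtype (𝒜 i)))
    (by simp [GradedMonoid.GOne.one])
    (by
      intro i j x y
      simp [GradedMonoid.GMul.mul, Polynomial.monomial_mul_monomial, add_mul])).comp
    (decomposeRingEquiv 𝒜).toRingHom

theorem scaledCoaction_of_mem (c : ℕ) {i : ℕ} {r : R} (hr : r ∈ 𝒜 i) :
    scaledCoaction 𝒜 c r = Polynomial.monomial (i * c) r := by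
  have : decomposeRingEquiv 𝒜 r = DirectSum.of (fun i => 𝒜 i) i ⟨r, hr⟩ :=
    decompose_of_mem 𝒜 hr
  rw [scaledCoaction, RingHom.comp_apply, RingEquiv.toRingHom_eq_coe, RingEquiv.coe_toRingHom,
    this, DirectSum.toSemiring_of]
  rfl

theorem dehomogenization_scaledCoaction (c : ℕ) (r : R) :
    dehomogenization R (scaledCoaction 𝒜 c r) = r := by
  induction r using DirectSum.Decomposition.inductionOn 𝒜 with
  | zero => simp only [map_zero]
  | add r s hr hs => rw [map_add, map_add, hr, hs]
  | @homogeneous i r =>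
    rw [scaledCoaction_of_mem 𝒜 c r.2]
    simp [dehomogenization]

/-- The map `F_*^e s ↦ φ (F_*^e (t ^ n * ∑ i, s_i * t ^ (i * (p ^ e - 1))))` evaluated at
`t = 1`. -/
noncomputable def dehomogenizedCartierMap (φ : CartierPiece p e (Polynomial R)) (n : ℕ) :
    CartierPiece p e R :=
  CartierPiece.ofAddMonoidHom
    ((dehomogenization R).toAddMonoidHom.comp
      (φ.toAddMonoidHom.comp
        ((FrobeniusPushforward.of p e (Polynomial R)).toAddMonoidHom.comp
          ((AddMonoidHom.mulLeft (Polynomial.X ^ n)).comp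
            (scaledCoaction 𝒜 (p ^ e - 1)).toAddMonoidHom))))
    (fun r s => by
      change dehomogenization R (φ (FrobeniusPushforward.of p e _
        (Polynomial.X ^ n * scaledCoaction 𝒜 (p ^ e - 1) (r ^ p ^ e * s)))) = r *
          dehomogenization R (φ (FrobeniusPushforward.of p e _
            (Polynomial.X ^ n * scaledCoaction 𝒜 (p ^ e - 1) s)))
      -- The coaction is multiplicative, so its value at `r` leaves `φ` as a factor and becomes `r`
      -- at `t = 1`.
      rw [map_mul (scaledCoaction 𝒜 _), map_pow, mul_left_comm, φ.map_pow_mul, map_mul,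
        dehomogenization_scaledCoaction])

theorem dehomogenizedCartierMap_apply (φ : CartierPiece p e (Polynomial R)) (n : ℕ) (s : R) :
    dehomogenizedCartierMap 𝒜 φ n (FrobeniusPushforward.of p e R s) =
      dehomogenization R (φ (FrobeniusPushforward.of p e _
        (Polynomial.X ^ n * scaledCoaction 𝒜 (p ^ e - 1) s))) :=
  rfl

theorem dehomogenizedCartierMap_gradedDegree (φ : CartierPiece p e (Polynomial R)) (f : R) :
    dehomogenizedCartierMap 𝒜 φ (gradedDegree 𝒜 f) (FrobeniusPushforward.of p e R f) =
      dehomogenization R (φ (FrobeniusPushforward.of p e _ (homogenization 𝒜 f))) := by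
  classical
  have hq : 0 < p ^ e := pow_pos (IsPrimeChar.prime (p := p) R).pos e
  conv_lhs => rw [← sum_support_decompose 𝒜 f]
  rw [homogenization]
  simp only [map_sum]
  refine Finset.sum_congr (by ext; simp) fun i hi => ?_
  have hi' := le_gradedDegree 𝒜 (f := f) (i := i) (by convert hi)
  rw [sum_support_decompose, dehomogenizedCartierMap_apply,
    scaledCoaction_of_mem 𝒜 _ (decompose 𝒜 f i).2]
  -- The exponent `i * (q - 1)` is chosen for this: the term becomes that of `f^h` times `(t ^ i) ^
  -- q`, which leaves `φ` as `t ^ i` and disappears at `t = 1`.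
  have : (Polynomial.X ^ gradedDegree 𝒜 f *
      Polynomial.monomial (i * (p ^ e - 1)) (decompose 𝒜 f i : R)) =
      (Polynomial.X ^ i) ^ p ^ e *
        (Polynomial.C (decompose 𝒜 f i : R) * Polynomial.X ^ (gradedDegree 𝒜 f - i)) := by
    obtain ⟨d, hd⟩ := Nat.exists_eq_add_of_le hi'
    obtain ⟨c, hc⟩ := Nat.exists_eq_add_of_le' hq
    rw [hd, hc, Nat.add_sub_cancel, Nat.add_sub_cancel_left,
      ← Polynomial.C_mul_X_pow_eq_monomial]
    ring
  rw [this, φ.map_pow_mul, map_mul]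
  simp [dehomogenization]

theorem homogenization_mem_cartierCore {J : Ideal R} {f : R} (hf : f ∈ cartierCore p J) :
    homogenization 𝒜 f ∈ cartierCore p (idealHomogenization 𝒜 J) := by
  let _ := totalGradedRing 𝒜
  intro e he φ
  rw [(idealHomogenization_isHomogeneous 𝒜 J).mem_iff]
  intro m
  refine mem_idealHomogenization_of_mem_totalGrading 𝒜
    (decompose (totalGrading 𝒜) (φ (FrobeniusPushforward.of p e _ (homogenization 𝒜 f))) m).2 ?_
  -- Since `f^h` is a form, each component of `φ (f^h)` is the value at `f^h` of a single Cartier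
  -- map, which then descends to `R`.
  rw [← cartierComponent_of_mem (totalGrading 𝒜) φ (homogenization_mem_totalGrading 𝒜 f),
    ← dehomogenizedCartierMap_gradedDegree]
  exact hf e he _

/-- Over any `ℕ`-graded ring in which `p = 0`, the Cartier core commutes with homogenization. -/
theorem idealHomogenization_cartierCore (J : Ideal R) :
    idealHomogenization 𝒜 (cartierCore p J) = cartierCore p (idealHomogenization 𝒜 J) := by
  let _ := totalGradedRing 𝒜
  apply le_antisymm
  · rw [idealHomogenization, Ideal.span_le]
    rintro _ ⟨f, hf, rfl⟩
    exact homogenization_mem_cartierCore 𝒜 hf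
  · intro g hg
    rw [(idealHomogenization_isHomogeneous 𝒜 _).mem_iff]
    intro n
    exact mem_idealHomogenization_of_mem_totalGrading 𝒜 (decompose (totalGrading 𝒜) g n).2
      (dehomogenization_mem_cartierCore 𝒜
        (cartierCore_isHomogeneous _ (idealHomogenization_isHomogeneous 𝒜 J) n hg))

theorem cartierCore_eq_image_dehomogenization (J : Ideal R) :
    (cartierCore p J : Set R) =
      dehomogenization R '' (cartierCore p (idealHomogenization 𝒜 J) : Set (Polynomial R)) := by
  ext f
  constructor
  · intro hf
    exact ⟨_, homogenization_mem_cartierCore 𝒜 hf, dehomogenization_homogenization 𝒜 f⟩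
  · rintro ⟨g, hg, rfl⟩
    exact dehomogenization_mem_cartierCore 𝒜 hg

end Dehomogenize

theorem mainTheorem7 (p : ℕ) [Fact p.Prime] {k : Type*} [Field k] [CharP k p]
    (hk : IsFFinite p k) (d : ℕ) (I : Ideal (MvPolynomial (Fin d) k))
    (hI : I.IsHomogeneous (MvPolynomial.homogeneousSubmodule (Fin d) k))
    (J : Ideal (MvPolynomial (Fin d) k ⧸ I)) :
    letI 𝒜 : ℕ → Submodule k (MvPolynomial (Fin d) k ⧸ I) :=
      quotientGrading (MvPolynomial.homogeneousSubmodule (Fin d) k) I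
    letI : GradedAlgebra 𝒜 :=
      quotientGradedAlgebra (MvPolynomial.homogeneousSubmodule (Fin d) k) I hI
    idealHomogenization 𝒜 (cartierCore p J) = cartierCore p (idealHomogenization 𝒜 J) ∧
      (cartierCore p J : Set (MvPolynomial (Fin d) k ⧸ I)) =
        dehomogenization (MvPolynomial (Fin d) k ⧸ I) ''
          (cartierCore p (idealHomogenization 𝒜 J) : Set _) := by
  let _ : GradedAlgebra (quotientGrading (MvPolynomial.homogeneousSubmodule (Fin d) k) I) :=
    quotientGradedAlgebra (MvPolynomial.homogeneousSubmodule (Fin d) k) I hI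
  exact ⟨idealHomogenization_cartierCore _ J, cartierCore_eq_image_dehomogenization _ J⟩
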